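/- All forms are sesquilinear and linear in the first argument. A nonnegative form $\mathfrak t$ in a Hilbert space is closed if $u_n\in\operatorname{dom}\mathfrak t$, $u_n\to u$, $\mathfrak t[u_n-u_m]\to0$ imply $u\in\operatorname{dom}\mathfrak t$ and $\mathfrak t[u_n-u]\to 0$. For a nonnegative symmetric operator $T$, the closed form $T[\cdot,\cdot]$ with domain $\mathcal D[T]$ is the closure (the smallest closed extension) of the form $(Tu,v)$, $u,v\in\operatorname{dom}T$; write $T[u]=T[u,u]$. If $T$ is selfadjoint, this is the closed form associated with $T$. Let $S$ be a closed densely defined symmetric operator in a complex Hilbert space $\mathfrak H$, and equip $\operatorname{dom}S^*$ with the norm $\|u\|_+^2=\|u\|^2+\|S^*u\|^2$. A triplet $\{\mathcal H,\Gamma_0,\Gamma_1\}$ is a generalized boundary triplet for $S^*$ if $\mathcal H$ is a Hilbert space and $\Gamma_0,\Gamma_1:\mathcal L\to\mathcal H$ are linear maps that are closable with respect to $\|\cdot\|_+$ and $\|\cdot\|_{\mathcal H}$, defined on a linear manifold $\mathcal L$ that is dense in $(\operatorname{dom}S^*,\|\cdot\|_+)$, such that $(S^*x,y)-(x,S^*y)=(\Gamma_1x,\Gamma_0y)_{\mathcal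 H}-(\Gamma_0x,\Gamma_1y)_{\mathcal H}$ for all $x,y\in\mathcal L$, the map $\Gamma_0:\mathcal L\to\mathcal H$ is surjective, and $S^*\!\upharpoonright\ker\Gamma_0$ is selfadjoint. **Theorem.** Let $\{\mathcal H,\Gamma_0,\Gamma_1\}$ be a generalized boundary triplet for $S^*$, where $S$ is a closed densely defined symmetric operator in $\mathfrak H$, and put $\widetilde S_i=S^*\!\upharpoonright\ker\Gamma_i$, $i=0,1$. Suppose that 1. the main transform $\widetilde{\mathcal A}$, that is, the operator in $\mathfrak H\oplus\mathcal H$ given by $\widetilde{\mathcal A}\begin{pmatrix}u\\ \Gamma_0u\end{pmatrix}=\begin{pmatrix}S^*u\\-\Gamma_1u\end{pmatrix}$, $u\in\mathcal L$, is a nonnegative selfadjoint operator; 2. the closed form associated with $\widetilde{\mathcal A}$ is given by $$\mathcal D[\widetilde{\mathcal A}]=\left\{\begin{pmatrix}v\\ \widetilde\Gamma_0v\end{pmatrix}: v\in\mathcal D[\widetilde S_1]\right\},\qquad \widetilde{\mathcal A}\left[\begin{pmatrix}v\\ \widetilde\Gamma_0v\end{pmatrix}\right]=\widetilde S_1[v],$$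 where $\widetilde\Gamma_0:\mathcal D[\widetilde S_1]\to\mathcal H$ is a linear operator that extends $\Gamma_0$. Then $\{\widetilde S_0,\widetilde S_1\}$ is a pair of nonnegative selfadjoint extensions of $S$ which satisfies the following conditions: * **(a)** $S$ is a densely defined nonnegative symmetric operator; * **(b)** $\widetilde S_0$ and $\widetilde S_1$ are nonnegative selfadjoint extensions of $S$ with $\operatorname{dom}\widetilde S_1\cap\operatorname{dom}\widetilde S_0=\operatorname{dom}S$; * **(c)** the form $\widetilde S_0[\cdot,\cdot]$ is a closed restriction of the form $\widetilde S_1[\cdot,\cdot]$. -/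

import Mathlib

open scoped ComplexOrder LinearPMap
open Filter Topology

noncomputable section

/-! ### Sesquilinear forms in a Hilbert space -/

/-- A sesquilinear form in `E`, defined on a linear manifold; it is linear in the first and
conjugate-linear in the second argument. -/
structure SesqForm (E : Type*) [NormedAddCommGroup E] [InnerProductSpace ℂ E] where
  /-- the domain of the form -/
  domain : Submodule ℂ E
  /-- the values of the form -/
  toFun : domain →ₗ[ℂ] domain →ₗ⋆[ℂ] ℂ

namespace SesqForm

variable {E : Type*} [NormedAddCommGroup E] [InnerProductSpace ℂ E]

/-- The form is nonnegative: `t[u] = t[u, u]` is real and `≥ 0`. -/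
def IsNonneg (t : SesqForm E) : Prop :=
  ∀ u : t.domain, 0 ≤ t.toFun u u

/-- A (nonnegative) form is closed if `uₙ → u` and `t[uₙ - uₘ] → 0` imply that `u ∈ dom t` and
`t[uₙ - u] → 0`. -/
def IsClosed (t : SesqForm E) : Prop :=
  ∀ (u : ℕ → t.domain) (v : E),
    Tendsto (fun n => (u n : E)) atTop (𝓝 v) →
    Tendsto (fun p : ℕ × ℕ => t.toFun (u p.1 - u p.2) (u p.1 - u p.2)) atTop (𝓝 0) →
    ∃ hv : v ∈ t.domain,
      Tendsto (fun n => t.toFun (u n - ⟨v, hv⟩) (u n - ⟨v, hv⟩)) atTop (𝓝 0)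

/-- `s ≤ t` means `s ⊆ t`: the form `s` is a restriction of the form `t`. -/
instance : LE (SesqForm E) where
  le s t := ∃ h : s.domain ≤ t.domain, ∀ u v : s.domain,
    s.toFun u v = t.toFun (Submodule.inclusion h u) (Submodule.inclusion h v)

/-- `s` is a closed restriction of `t`. -/
def IsClosedRestriction (s t : SesqForm E) : Prop :=
  s.IsClosed ∧ s ≤ t

/-- `c` is the smallest closed (nonnegative) extension of `t`. -/
def IsClosureOf (c t : SesqForm E) : Prop :=
  IsLeast {g : SesqForm E | g.IsNonneg ∧ g.IsClosed ∧ t ≤ g} c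

open Classical in
/-- The closure of the form `t`: its smallest closed extension. It exists if `t` is a closable
nonnegative form; otherwise the junk value is `t`. -/
def closure (t : SesqForm E) : SesqForm E :=
  if h : ∃ c : SesqForm E, c.IsClosureOf t then h.choose else t

end SesqForm

/-! ### Operators -/

namespace LinearPMap

variable {E : Type*} [NormedAddCommGroup E] [InnerProductSpace ℂ E]

/-- The operator `T` is nonnegative: `(T u, u) ≥ 0` for all `u ∈ dom T`. -/
def IsNonnegOp (T : E →ₗ.[ℂ] E) : Prop :=
  ∀ u : T.domain, 0 ≤ inner ℂ (u : E) (T u)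

/-- The operator `T` is symmetric: `(T u, v) = (u, T v)` for all `u, v ∈ dom T`. -/
def IsSymmetricOp (T : E →ₗ.[ℂ] E) : Prop :=
  T.IsFormalAdjoint T

/-- The form `(T u, v)`, `u, v ∈ dom T`. (Mathlib's `inner ℂ x y` is linear in `y`.) -/
def opForm (T : E →ₗ.[ℂ] E) : SesqForm E where
  domain := T.domain
  toFun := LinearMap.mk₂'ₛₗ (RingHom.id ℂ) (starRingEnd ℂ)
    (fun u v => inner ℂ (v : E) (T u))
    (fun u u' v => by simp [LinearPMap.map_add])
    (fun c u v => by simp [LinearPMap.map_smul])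
    (fun u v v' => by simp)
    (fun c u v => by simp [mul_comm])

/-- The closed form `T[·,·]` of a nonnegative symmetric operator `T`, i.e. the closure of the form
`(T u, v)`, `u, v ∈ dom T`. Its domain is `𝒟[T]`. For a nonnegative selfadjoint `T` this is the
closed form associated with `T` by the representation theorem. -/
def closedForm (T : E →ₗ.[ℂ] E) : SesqForm E :=
  T.opForm.closure

/-- The restriction `T ↾ ker Γ` of the operator `T`, where `Γ` is defined on a linear
manifold `L`. -/
def restrictKer (T : E →ₗ.[ℂ] E) {K : Type*} [AddCommGroup K] [Module ℂ K] {L : Submodule ℂ E}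
    (Γ : L →ₗ[ℂ] K) : E →ₗ.[ℂ] E :=
  T.domRestrict ((LinearMap.ker Γ).map L.subtype)

end LinearPMap

/-! ### Generalized boundary triplets -/

section

variable {E : Type*} [NormedAddCommGroup E] [InnerProductSpace ℂ E] [CompleteSpace E]

/-- A generalized boundary triplet `{K, Γ₀, Γ₁}` for `S*`, where `S` is a closed densely defined
symmetric operator: `Γ₀` and `Γ₁` are defined on a linear manifold `L ⊆ dom S*` which is dense in
`dom S*` with respect to the graph norm `‖u‖₊² = ‖u‖² + ‖S* u‖²`, and they are closable with respect
to `‖·‖₊`; Green's identity holds on `L`, `Γ₀` is surjective, and `S* ↾ ker Γ₀` is selfadjoint. -/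
structure GeneralizedBoundaryTriplet (S : E →ₗ.[ℂ] E) (K : Type*) [NormedAddCommGroup K]
    [InnerProductSpace ℂ K] where
  /-- the common domain of the boundary mappings -/
  L : Submodule ℂ E
  le_domain : L ≤ S†.domain
  /-- the first boundary mapping -/
  Γ₀ : L →ₗ[ℂ] K
  /-- the second boundary mapping -/
  Γ₁ : L →ₗ[ℂ] K
  dense : ∀ x : S†.domain, ∃ u : ℕ → L,
    Tendsto (fun n => (u n : E)) atTop (𝓝 (x : E)) ∧
    Tendsto (fun n => S† (Submodule.inclusion le_domain (u n))) atTop (𝓝 (S† x))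
  closable₀ : ∀ (u : ℕ → L) (e : K), Tendsto (fun n => (u n : E)) atTop (𝓝 0) →
    Tendsto (fun n => S† (Submodule.inclusion le_domain (u n))) atTop (𝓝 0) →
    Tendsto (fun n => Γ₀ (u n)) atTop (𝓝 e) → e = 0
  closable₁ : ∀ (u : ℕ → L) (e : K), Tendsto (fun n => (u n : E)) atTop (𝓝 0) →
    Tendsto (fun n => S† (Submodule.inclusion le_domain (u n))) atTop (𝓝 0) →
    Tendsto (fun n => Γ₁ (u n)) atTop (𝓝 e) → e = 0
  green : ∀ x y : L,
    inner ℂ (y : E) (S† (Submodule.inclusion le_domain x)) -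
        inner ℂ (S† (Submodule.inclusion le_domain y)) (x : E) =
      inner ℂ (Γ₀ y) (Γ₁ x) - inner ℂ (Γ₁ y) (Γ₀ x)
  surjective₀ : Function.Surjective Γ₀
  selfAdjoint₀ : IsSelfAdjoint (S†.restrictKer Γ₀)

namespace GeneralizedBoundaryTriplet

variable {S : E →ₗ.[ℂ] E} {K : Type*} [NormedAddCommGroup K] [InnerProductSpace ℂ K]

/-- The operator `S₀ = S* ↾ ker Γ₀`. -/
def ext₀ (B : GeneralizedBoundaryTriplet S K) : E →ₗ.[ℂ] E :=
  S†.restrictKer B.Γ₀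

/-- The operator `S₁ = S* ↾ ker Γ₁`. -/
def ext₁ (B : GeneralizedBoundaryTriplet S K) : E →ₗ.[ℂ] E :=
  S†.restrictKer B.Γ₁

/-- The map `u ↦ (u, Γ₀ u)` from `L` into the Hilbert space `E ⊕ K`. -/
def inMap (B : GeneralizedBoundaryTriplet S K) : B.L →ₗ[ℂ] WithLp 2 (E × K) :=
  (WithLp.linearEquiv 2 ℂ (E × K)).symm.toLinearMap ∘ₗ (B.L.subtype.prod B.Γ₀)

/-- The map `u ↦ (S* u, -Γ₁ u)` from `L` into the Hilbert space `E ⊕ K`. -/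
def outMap (B : GeneralizedBoundaryTriplet S K) : B.L →ₗ[ℂ] WithLp 2 (E × K) :=
  (WithLp.linearEquiv 2 ℂ (E × K)).symm.toLinearMap ∘ₗ
    ((S†.toFun ∘ₗ Submodule.inclusion B.le_domain).prod (-B.Γ₁))

theorem inMap_injective (B : GeneralizedBoundaryTriplet S K) : Function.Injective B.inMap := by
  intro u v h
  have h1 := congrArg (fun p : WithLp 2 (E × K) => p.fst) h
  exact Subtype.ext h1

/-- The main transform: the operator `(u, Γ₀ u) ↦ (S* u, -Γ₁ u)`, `u ∈ L`, in the Hilbert space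
`E ⊕ K`. -/
def mainTransform (B : GeneralizedBoundaryTriplet S K) :
    WithLp 2 (E × K) →ₗ.[ℂ] WithLp 2 (E × K) where
  domain := LinearMap.range B.inMap
  toFun := B.outMap ∘ₗ (LinearEquiv.ofInjective B.inMap B.inMap_injective).symm.toLinearMap

end GeneralizedBoundaryTriplet

/-- `{S₀, S₁}` is a pair of nonnegative selfadjoint extensions of the operator `S` such that
the conditions (a), (b), (c) hold. -/
structure IsSpecialPair (S S₀ S₁ : E →ₗ.[ℂ] E) : Prop where
  /-- (a) `S` is a densely defined nonnegative symmetric operator. -/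
  dense : Dense (S.domain : Set E)
  symmetric : S.IsSymmetricOp
  nonneg : S.IsNonnegOp
  /-- (b) `S₀` and `S₁` are nonnegative selfadjoint extensions of `S` with
  `dom S₁ ∩ dom S₀ = dom S`. -/
  le₀ : S ≤ S₀
  le₁ : S ≤ S₁
  selfAdjoint₀ : IsSelfAdjoint S₀
  selfAdjoint₁ : IsSelfAdjoint S₁
  nonneg₀ : S₀.IsNonnegOp
  nonneg₁ : S₁.IsNonnegOp
  disjoint : S₁.domain ⊓ S₀.domain = S.domain
  /-- (c) The form `S₀[·,·]` is a closed restriction of the form `S₁[·,·]`. -/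
  closedRestriction : S₀.closedForm.IsClosedRestriction S₁.closedForm

end

end

noncomputable section

/-! ### Nonnegative forms, polarization and form spaces -/

namespace SesqForm

variable {E : Type*} [NormedAddCommGroup E] [InnerProductSpace ℂ E]

/-! Polarizing the second hypothesis gives, for `x ∈ 𝒟[S₁]` and `u ∈ L`, the identity `S₁[x, u] =
((x, Γt x), (S* u, -Γ₁ u))`, since the form of a nonnegative symmetric operator is represented by
that operator. Everything hard follows from this identity (`hrep`).

Selfadjointness of `S₁`: Green's identity gives symmetry, so `ran (S₁ + 1) = E` is enough. For given
`f`, Riesz' theorem in the form space yields `x` with `S₁[x, v] + (x, v) = (f, v)`. Taking `v = u ∈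
L` shows that `(x, Γt x)` lies in the domain of the adjoint of the main transform and is sent to `(f
- x, 0)`. As the main transform is selfadjoint, `x ∈ L`, `S* x = f - x` and `Γ₁ x = 0`, that is, `S₁
x + x = f`.

Condition (c): on `ker Γ₀` the identity reduces to `S₁[u, v] = (u, S* v) = (S₀ u, v)`. So `S₁[·,·]`
is a closed extension of the form of `S₀`, and minimality of the closure finishes. The domain
condition in (b) is Green's identity combined with `S** = S`.

Closures of forms are defined as least closed extensions, so their existence must be proved: the
completion of `dom T` in the energy norm, embedded in `E`, realizes the closure
(`ofEmbedding_isClosureOf`). -/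

theorem IsNonneg.conj_symm {t : SesqForm E} (ht : t.IsNonneg) (u v : t.domain) :
    starRingEnd ℂ (t.toFun u v) = t.toFun v u := by
  have h1 := (Complex.nonneg_iff.1 (ht (u + v))).2
  have h2 := (Complex.nonneg_iff.1 (ht (u + Complex.I • v))).2
  have hu := (Complex.nonneg_iff.1 (ht u)).2
  have hv := (Complex.nonneg_iff.1 (ht v)).2
  simp only [map_add, LinearMap.add_apply, map_smulₛₗ, LinearMap.smul_apply, smul_eq_mul,
    Complex.add_im, Complex.mul_im, Complex.conj_I, Complex.neg_re, Complex.neg_im, Complex.I_re,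
    Complex.I_im, Complex.mul_re, RingHom.id_apply, Complex.add_re] at h1 h2
  apply Complex.ext
  · rw [Complex.conj_re]; linarith
  · rw [Complex.conj_im]; linarith

/-- A sesquilinear form is determined by its diagonal values. -/
theorem polarization (t : SesqForm E) (u v : t.domain) :
    t.toFun u v = (1 / 4) * (t.toFun (u + v) (u + v) - t.toFun (u - v) (u - v)
      + Complex.I * (t.toFun (u + Complex.I • v) (u + Complex.I • v)
        - t.toFun (u - Complex.I • v) (u - Complex.I • v))) := by
  simp only [map_add, map_sub, LinearMap.add_apply, LinearMap.sub_apply, map_smulₛₗ,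
    LinearMap.smul_apply, smul_eq_mul, Complex.conj_I, RingHom.id_apply]
  linear_combination ((1 / 2) * t.toFun u v - (1 / 2) * t.toFun v u) * Complex.I_sq

theorem map_eq_of_map_self_eq {F : Type*} [NormedAddCommGroup F] [InnerProductSpace ℂ F]
    {s : SesqForm E} {t : SesqForm F} (φ : s.domain →ₗ[ℂ] t.domain)
    (h : ∀ u, t.toFun (φ u) (φ u) = s.toFun u u) (u v : s.domain) :
    t.toFun (φ u) (φ v) = s.toFun u v := by
  rw [t.polarization, s.polarization]
  simp only [← h, ← map_add, ← map_sub, ← map_smul]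

/-- The domain of a nonnegative form `t`, equipped with the inner product `t[u, v] + (u, v)`. -/
def FormSpace (t : SesqForm E) (_ : t.IsNonneg) : Type _ := t.domain

namespace FormSpace

variable {t : SesqForm E} (ht : t.IsNonneg)

instance : AddCommGroup (t.FormSpace ht) := inferInstanceAs (AddCommGroup t.domain)

instance : Module ℂ (t.FormSpace ht) := inferInstanceAs (Module ℂ t.domain)

/-- The identification of the form domain with the form space. -/
def equiv : t.domain ≃ₗ[ℂ] t.FormSpace ht := LinearEquiv.refl ℂ t.domain

/-- The inner product `t[u, v] + (u, v)` on the form space. -/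
@[reducible]
def core : InnerProductSpace.Core ℂ (t.FormSpace ht) where
  -- The arguments are swapped because forms are linear in the first slot and `inner` in the second.
  inner u v := t.toFun ((equiv ht).symm v) ((equiv ht).symm u)
    + inner ℂ ((equiv ht).symm u : E) ((equiv ht).symm v : E)
  conj_inner_symm u v := by simp [ht.conj_symm]
  re_inner_nonneg u := by
    have h := (Complex.nonneg_iff.1 (ht ((equiv ht).symm u))).1
    have h' : 0 ≤ (inner ℂ ((equiv ht).symm u : E) ((equiv ht).symm u : E)).re :=
      inner_self_nonneg (𝕜 := ℂ)
    simpa using add_nonneg h h'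
  add_left u v w := by simp; ring
  smul_left u v c := by simp; ring
  definite u h := by
    have h1 := (Complex.nonneg_iff.1 (ht ((equiv ht).symm u))).1
    have h2 : 0 ≤ (inner ℂ ((equiv ht).symm u : E) ((equiv ht).symm u : E)).re :=
      inner_self_nonneg (𝕜 := ℂ)
    have h3 := congrArg Complex.re h
    simp only [Complex.add_re, Complex.zero_re] at h3
    have h4 : (inner ℂ ((equiv ht).symm u : E) ((equiv ht).symm u : E)).re = 0 := by linarith
    have h5 : ((equiv ht).symm u : E) = 0 := by
      rw [← norm_eq_zero, ← sq_eq_zero_iff, @norm_sq_eq_re_inner ℂ]; exact h4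
    exact (equiv ht).symm.map_eq_zero_iff.1 (Subtype.ext h5)

instance : NormedAddCommGroup (t.FormSpace ht) := (core ht).toNormedAddCommGroup

instance : InnerProductSpace ℂ (t.FormSpace ht) := InnerProductSpace.ofCore (core ht).toCore

theorem inner_equiv (u v : t.domain) :
    inner ℂ (equiv ht u) (equiv ht v) = t.toFun v u + inner ℂ (u : E) (v : E) := rfl

theorem norm_sq_equiv (u : t.domain) :
    ‖equiv ht u‖ ^ 2 = (t.toFun u u).re + ‖(u : E)‖ ^ 2 := by
  rw [@norm_sq_eq_re_inner ℂ, @norm_sq_eq_re_inner ℂ _ _ _ _ (u : E), inner_equiv]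
  simp

theorem norm_coe_le (u : t.domain) : ‖(u : E)‖ ≤ ‖equiv ht u‖ := by
  refine le_of_sq_le_sq ?_ (norm_nonneg _)
  rw [norm_sq_equiv]
  linarith [(Complex.nonneg_iff.1 (ht u)).1]

/-- The contractive embedding of the form space into the ambient space. -/
def incl : t.FormSpace ht →L[ℂ] E :=
  LinearMap.mkContinuous (t.domain.subtype ∘ₗ (equiv ht).symm.toLinearMap) 1 fun u => by
    rw [one_mul]; exact norm_coe_le ht ((equiv ht).symm u)

@[simp]
theorem incl_equiv (u : t.domain) : incl ht (equiv ht u) = u := rfl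

/-- The form norm dominates both `‖·‖` and `t[·]`, so a Cauchy sequence converges in `E` and is
Cauchy for `t`; closedness supplies the limit for both parts of the norm. -/
theorem completeSpace (hc : t.IsClosed) [CompleteSpace E] : CompleteSpace (t.FormSpace ht) := by
  refine Metric.complete_of_cauchySeq_tendsto fun u hu => ?_
  obtain ⟨v, hv⟩ := cauchySeq_tendsto_of_complete
    ((incl ht).uniformContinuous.comp_cauchySeq hu)
  have hd : Tendsto (fun p : ℕ × ℕ => ‖u p.1 - u p.2‖ ^ 2) atTop (𝓝 0) := by
    have := (cauchySeq_iff_tendsto_dist_atTop_0.1 hu).pow 2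
    simpa [dist_eq_norm] using this
  obtain ⟨hvt, hlim⟩ := hc (fun n => (equiv ht).symm (u n)) v hv <| by
    rw [tendsto_zero_iff_norm_tendsto_zero]
    refine squeeze_zero (fun _ => norm_nonneg _) (fun p => ?_) hd
    have h0 := ht ((equiv ht).symm (u p.1) - (equiv ht).symm (u p.2))
    have h1 := norm_sq_equiv ht ((equiv ht).symm (u p.1) - (equiv ht).symm (u p.2))
    rw [map_sub, LinearEquiv.apply_symm_apply, LinearEquiv.apply_symm_apply] at h1
    rw [← Complex.re_eq_norm.2 h0, h1]
    exact le_add_of_nonneg_right (sq_nonneg _)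
  refine ⟨equiv ht ⟨v, hvt⟩, tendsto_iff_norm_sub_tendsto_zero.2 ?_⟩
  have h2 : Tendsto (fun n => ‖u n - equiv ht ⟨v, hvt⟩‖ ^ 2) atTop (𝓝 0) := by
    have h3 : Tendsto (fun n => ‖incl ht (u n) - v‖ ^ 2) atTop (𝓝 0) := by
      simpa using (tendsto_iff_norm_sub_tendsto_zero.1 hv).pow 2
    have h4 := ((Complex.continuous_re.tendsto 0).comp hlim).add h3
    simp only [Complex.zero_re, add_zero] at h4
    refine h4.congr fun n => ?_
    have h5 := norm_sq_equiv ht ((equiv ht).symm (u n) - ⟨v, hvt⟩)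
    rw [map_sub, LinearEquiv.apply_symm_apply] at h5
    rw [h5]; rfl
  simpa using h2.sqrt

end FormSpace

/-- Riesz' theorem for closed forms: `t[x, v] + (x, v) = (f, v)` is solvable for every `f`. -/
theorem IsClosed.exists_add_inner_eq [CompleteSpace E] {t : SesqForm E} (ht : t.IsNonneg)
    (hc : t.IsClosed) (f : E) :
    ∃ x : t.domain, ∀ v : t.domain,
      t.toFun x v + inner ℂ (v : E) (x : E) = inner ℂ (v : E) f := by
  have := FormSpace.completeSpace ht hc
  -- The Riesz representative of `v ↦ (f, v)` is the adjoint of the embedding, applied to `f`.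
  refine ⟨(FormSpace.equiv ht).symm ((FormSpace.incl ht).adjoint f), fun v => ?_⟩
  have h := (FormSpace.incl ht).adjoint_inner_right (FormSpace.equiv ht v) f
  rw [FormSpace.incl_equiv] at h
  rw [← h, ← FormSpace.inner_equiv ht, LinearEquiv.apply_symm_apply]

/-! ### Forms induced by an injective embedding of a Hilbert space -/

section Embedding

variable {H : Type*} [NormedAddCommGroup H] [InnerProductSpace ℂ H] (ι : H →L[ℂ] E)
  (hι : Function.Injective ι)

/-- The form with domain `range ι` such that the inner product of `H` becomes
`t[u, v] + (u, v)`. -/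
def ofEmbedding : SesqForm E where
  domain := LinearMap.range ι.toLinearMap
  toFun :=
    let e := (LinearEquiv.ofInjective ι.toLinearMap hι).symm
    LinearMap.mk₂'ₛₗ (RingHom.id ℂ) (starRingEnd ℂ)
      (fun u v => inner ℂ (e v) (e u) - inner ℂ (v : E) (u : E))
      (fun u u' v => by simp; ring)
      (fun c u v => by simp; ring)
      (fun u v v' => by simp; ring)
      (fun c u v => by simp; ring)

/-- The element `ι h` of the domain of `ofEmbedding ι`. -/
def embed : H ≃ₗ[ℂ] (ofEmbedding ι hι).domain := LinearEquiv.ofInjective ι.toLinearMap hι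

@[simp]
theorem coe_embed (h : H) : (embed ι hι h : E) = ι h := rfl

theorem ofEmbedding_embed (h k : H) :
    (ofEmbedding ι hι).toFun (embed ι hι h) (embed ι hι k)
      = inner ℂ k h - inner ℂ (ι k) (ι h) := by
  change inner ℂ ((embed ι hι).symm (embed ι hι k)) ((embed ι hι).symm (embed ι hι h)) - _ = _
  simp

theorem ofEmbedding_embed_self (h : H) :
    (ofEmbedding ι hι).toFun (embed ι hι h) (embed ι hι h)
      = ((‖h‖ ^ 2 - ‖ι h‖ ^ 2 : ℝ) : ℂ) := by
  rw [ofEmbedding_embed, inner_self_eq_norm_sq_to_K, inner_self_eq_norm_sq_to_K]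
  simp

theorem ofEmbedding_isNonneg (hle : ∀ h, ‖ι h‖ ≤ ‖h‖) : (ofEmbedding ι hι).IsNonneg := by
  intro u
  obtain ⟨h, rfl⟩ := (embed ι hι).surjective u
  rw [ofEmbedding_embed_self, Complex.zero_le_real, sub_nonneg]
  exact pow_le_pow_left₀ (norm_nonneg _) (hle h) 2

/-- Since `‖h‖² = t[ι h] + ‖ι h‖²`, convergence in `E` together with the Cauchy property for `t` is
the Cauchy property in `H`, which is complete. -/
theorem ofEmbedding_isClosed [CompleteSpace H] : (ofEmbedding ι hι).IsClosed := by
  intro u v hu ht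
  obtain ⟨h, rfl⟩ : ∃ h : ℕ → H, u = fun n => embed ι hι (h n) :=
    ⟨fun n => (embed ι hι).symm (u n), by simp⟩
  simp only [← map_sub, ofEmbedding_embed_self, coe_embed] at hu ht
  have ht' := (Complex.continuous_re.tendsto 0).comp ht
  have hu' := (cauchySeq_iff_tendsto_dist_atTop_0.1 hu.cauchySeq).pow 2
  have hsum := ht'.add hu'
  simp only [Function.comp_def, Complex.ofReal_re, Complex.zero_re, dist_eq_norm, ← map_sub,
    sub_add_cancel, zero_add, ne_eq, OfNat.ofNat_ne_zero, not_false_eq_true, zero_pow] at hsum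
  have hcau : CauchySeq h := by
    rw [cauchySeq_iff_tendsto_dist_atTop_0]
    simpa [dist_eq_norm] using hsum.sqrt
  obtain ⟨k, hk⟩ := cauchySeq_tendsto_of_complete hcau
  obtain rfl : ι k = v := tendsto_nhds_unique ((ι.continuous.tendsto k).comp hk) hu
  refine ⟨(embed ι hι k).2, ?_⟩
  have h1 : Tendsto (fun n => ((‖h n - k‖ ^ 2 - ‖ι (h n - k)‖ ^ 2 : ℝ) : ℂ)) atTop (𝓝 0) := by
    have h2 : Tendsto (fun n => h n - k) atTop (𝓝 0) := by
      simpa using hk.sub_const k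
    have hcont : Continuous fun y : H => ((‖y‖ ^ 2 - ‖ι y‖ ^ 2 : ℝ) : ℂ) := by fun_prop
    have h3 := (hcont.tendsto 0).comp h2
    simp only [map_zero, norm_zero, sub_self, Complex.ofReal_zero] at h3
    exact h3
  refine h1.congr fun n => ?_
  rw [← ofEmbedding_embed_self ι hι, map_sub]
  rfl

end Embedding

end SesqForm

/-! ### Closure of the form of a nonnegative symmetric operator -/

namespace LinearPMap

open UniformSpace

variable {E : Type*} [NormedAddCommGroup E] [InnerProductSpace ℂ E]

theorem opForm_apply (T : E →ₗ.[ℂ] E) (u v : T.domain) :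
    T.opForm.toFun u v = inner ℂ (v : E) (T u) := rfl

variable {T : E →ₗ.[ℂ] E}

theorem IsNonnegOp.opForm_isNonneg (hT : T.IsNonnegOp) : T.opForm.IsNonneg := hT

/-- The completion of the domain of a nonnegative operator `T` with respect to the inner product
`(T u, v) + (u, v)`. -/
abbrev EnergySpace (hT : T.IsNonnegOp) : Type _ :=
  Completion (T.opForm.FormSpace hT.opForm_isNonneg)

variable [CompleteSpace E] (hT : T.IsNonnegOp)

/-- The canonical map from the energy space into the ambient space. -/
def energyIncl : EnergySpace hT →L[ℂ] E :=
  (SesqForm.FormSpace.incl hT.opForm_isNonneg).extend Completion.toComplL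

/-- The canonical map from the domain of the operator into the energy space. -/
def toEnergy (u : T.domain) : EnergySpace hT :=
  (SesqForm.FormSpace.equiv hT.opForm_isNonneg u : T.opForm.FormSpace hT.opForm_isNonneg)

theorem energyIncl_coe (u : T.opForm.FormSpace hT.opForm_isNonneg) :
    energyIncl hT u = SesqForm.FormSpace.incl hT.opForm_isNonneg u :=
  ContinuousLinearMap.extend_eq _ Completion.denseRange_coe
    (Completion.isUniformInducing_coe _) u

@[simp]
theorem energyIncl_toEnergy (u : T.domain) : energyIncl hT (toEnergy hT u) = u :=
  energyIncl_coe hT _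

theorem norm_energyIncl_le (h : EnergySpace hT) : ‖energyIncl hT h‖ ≤ ‖h‖ := by
  induction h using Completion.induction_on with
  | hp => exact isClosed_le (by fun_prop) (by fun_prop)
  | ih u =>
    rw [energyIncl_coe, Completion.norm_coe]
    exact SesqForm.FormSpace.norm_coe_le hT.opForm_isNonneg
      ((SesqForm.FormSpace.equiv hT.opForm_isNonneg).symm u)

/-- For `h` in `dom T` this is symmetry of `T`; both sides are continuous in `h`. -/
theorem inner_toEnergy (hs : T.IsSymmetricOp) (w : T.domain) (h : EnergySpace hT) :
    inner ℂ (toEnergy hT w) h = inner ℂ (T w + w) (energyIncl hT h) := by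
  induction h using Completion.induction_on with
  | hp => exact isClosed_eq (by fun_prop) (by fun_prop)
  | ih u =>
    obtain ⟨u, rfl⟩ := (SesqForm.FormSpace.equiv hT.opForm_isNonneg).surjective u
    rw [energyIncl_coe, SesqForm.FormSpace.incl_equiv, inner_add_left, hs w u]
    exact (Completion.inner_coe _ _).trans (SesqForm.FormSpace.inner_equiv _ _ _)

/-- This is closability of the form: by `inner_toEnergy`, an element of the kernel is orthogonal to
the dense image of `dom T`. -/
theorem energyIncl_injective (hs : T.IsSymmetricOp) : Function.Injective (energyIncl hT) := by
  rw [injective_iff_map_eq_zero]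
  intro h hh
  have key (k : EnergySpace hT) : inner ℂ k h = 0 := by
    induction k using Completion.induction_on with
    | hp => exact isClosed_eq (by fun_prop) (by fun_prop)
    | ih u =>
      have := inner_toEnergy hT hs ((SesqForm.FormSpace.equiv hT.opForm_isNonneg).symm u) h
      rwa [hh, inner_zero_right] at this
  exact inner_self_eq_zero.1 (key h)

/-- The form induced by the energy space is the smallest closed extension of the form of `T`. -/
theorem ofEmbedding_isClosureOf (hs : T.IsSymmetricOp) :
    (SesqForm.ofEmbedding (energyIncl hT) (energyIncl_injective hT hs)).IsClosureOf T.opForm := by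
  have hι := energyIncl_injective hT hs
  refine ⟨⟨SesqForm.ofEmbedding_isNonneg _ _ (norm_energyIncl_le hT),
    SesqForm.ofEmbedding_isClosed _ _, ?_⟩, ?_⟩
  · have hle : T.opForm.domain ≤ (SesqForm.ofEmbedding (energyIncl hT) hι).domain :=
      fun u hu => ⟨toEnergy hT ⟨u, hu⟩, energyIncl_toEnergy hT ⟨u, hu⟩⟩
    refine ⟨hle, fun u v => ?_⟩
    have hmem (w : T.opForm.domain) (hw) :
        (⟨(w : E), hw⟩ : (SesqForm.ofEmbedding (energyIncl hT) hι).domain)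
          = SesqForm.embed (energyIncl hT) hι (toEnergy hT w) :=
      Subtype.ext (energyIncl_toEnergy hT w).symm
    have h1 : inner ℂ (toEnergy hT v) (toEnergy hT u) = T.opForm.toFun u v + inner ℂ (v : E) u :=
      (Completion.inner_coe _ _).trans (SesqForm.FormSpace.inner_equiv _ _ _)
    rw [Submodule.inclusion_apply, Submodule.inclusion_apply, hmem, hmem,
      SesqForm.ofEmbedding_embed, h1]
    refine (sub_eq_of_eq_add ?_).symm
    rw [show energyIncl hT (toEnergy hT u) = u from energyIncl_toEnergy hT u,
      show energyIncl hT (toEnergy hT v) = v from energyIncl_toEnergy hT v]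
  · rintro g ⟨hg, hgc, hle, hgv⟩
    have := SesqForm.FormSpace.completeSpace hg hgc
    -- For any closed extension `g`, the inclusion of form spaces is isometric. It extends to the
    -- completion because the form space of `g` is complete, and it remains compatible with the
    -- embeddings into `E`.
    let j₀ : T.opForm.FormSpace hT.opForm_isNonneg →ₗᵢ[ℂ] g.FormSpace hg :=
      LinearMap.isometryOfInner ((SesqForm.FormSpace.equiv hg).toLinearMap ∘ₗ
        Submodule.inclusion hle ∘ₗ (SesqForm.FormSpace.equiv hT.opForm_isNonneg).symm.toLinearMap)
        fun u v => by
          obtain ⟨u, rfl⟩ := (SesqForm.FormSpace.equiv hT.opForm_isNonneg).surjective u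
          obtain ⟨v, rfl⟩ := (SesqForm.FormSpace.equiv hT.opForm_isNonneg).surjective v
          simp only [LinearMap.comp_apply, LinearEquiv.coe_coe, LinearEquiv.symm_apply_apply,
            SesqForm.FormSpace.inner_equiv, hgv]
          rfl
    let j : EnergySpace hT →L[ℂ] g.FormSpace hg :=
      j₀.toContinuousLinearMap.extend Completion.toComplL
    have hj (u : T.opForm.FormSpace hT.opForm_isNonneg) : j u = j₀ u :=
      ContinuousLinearMap.extend_eq _ Completion.denseRange_coe
        (Completion.isUniformInducing_coe _) u
    have hinner (h k : EnergySpace hT) : inner ℂ (j h) (j k) = inner ℂ h k := by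
      induction h, k using Completion.induction_on₂ with
      | hp => exact isClosed_eq (by fun_prop) (by fun_prop)
      | ih u v => rw [hj, hj, Completion.inner_coe, j₀.inner_map_map]
    have hincl (h : EnergySpace hT) : SesqForm.FormSpace.incl hg (j h) = energyIncl hT h := by
      induction h using Completion.induction_on with
      | hp => exact isClosed_eq (by fun_prop) (by fun_prop)
      | ih u => rw [hj, energyIncl_coe]; rfl
    have hmem (h : EnergySpace hT) (hm) : (⟨energyIncl hT h, hm⟩ : g.domain)
        = (SesqForm.FormSpace.equiv hg).symm (j h) := Subtype.ext (hincl h).symm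
    refine ⟨?_, fun u v => ?_⟩
    · rintro _ ⟨h, rfl⟩
      change energyIncl hT h ∈ g.domain
      rw [← hincl]
      exact ((SesqForm.FormSpace.equiv hg).symm (j h)).2
    · obtain ⟨h, rfl⟩ := (SesqForm.embed (energyIncl hT) hι).surjective u
      obtain ⟨k, rfl⟩ := (SesqForm.embed (energyIncl hT) hι).surjective v
      simp only [SesqForm.ofEmbedding_embed, Submodule.inclusion_apply, SesqForm.coe_embed, hmem]
      rw [← hinner, ← hincl, ← hincl]
      obtain ⟨x, hx⟩ := (SesqForm.FormSpace.equiv hg).surjective (j h)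
      obtain ⟨y, hy⟩ := (SesqForm.FormSpace.equiv hg).surjective (j k)
      rw [← hx, ← hy, SesqForm.FormSpace.inner_equiv]
      simp

include hT in
theorem closedForm_isClosureOf (hs : T.IsSymmetricOp) : T.closedForm.IsClosureOf T.opForm := by
  have h : ∃ c : SesqForm E, c.IsClosureOf T.opForm := ⟨_, ofEmbedding_isClosureOf hT hs⟩
  rw [closedForm, SesqForm.closure, dif_pos h]
  exact h.choose_spec

include hT in
/-- First representation theorem, the part on the domain of the operator. -/
theorem closedForm_apply_right (hs : T.IsSymmetricOp) (v : T.closedForm.domain) (w : T.domain)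
    (hw : (w : E) ∈ T.closedForm.domain) :
    T.closedForm.toFun v ⟨w, hw⟩ = inner ℂ (T w) (v : E) := by
  have hι := energyIncl_injective hT hs
  obtain ⟨hle, hval⟩ := (closedForm_isClosureOf hT hs).2 (ofEmbedding_isClosureOf hT hs).1
  have hmem (x : E) (hx) (h : EnergySpace hT) (hh : energyIncl hT h = x) :
      (⟨x, hx⟩ : (SesqForm.ofEmbedding (energyIncl hT) hι).domain)
        = SesqForm.embed (energyIncl hT) hι h := Subtype.ext hh.symm
  obtain ⟨h, hh⟩ := hle v.2
  rw [hval]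
  simp only [Submodule.inclusion_apply]
  rw [hmem v _ h hh, hmem w _ (toEnergy hT w) (energyIncl_toEnergy hT w),
    SesqForm.ofEmbedding_embed, inner_toEnergy hT hs, energyIncl_toEnergy, inner_add_left,
    add_sub_cancel_right]
  exact congrArg _ hh

include hT in
-- Passing to the energy completion adds only limits in `E` of elements of `dom T`. This yields
-- density of `dom S₁` before `S₁` is known to be selfadjoint.
theorem closedForm_domain_subset_closure (hs : T.IsSymmetricOp) :
    (T.closedForm.domain : Set E) ⊆ _root_.closure (T.domain : Set E) := by
  intro v hv
  obtain ⟨hle, -⟩ := (closedForm_isClosureOf hT hs).2 (ofEmbedding_isClosureOf hT hs).1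
  obtain ⟨h, rfl⟩ := hle hv
  clear hv
  change energyIncl hT h ∈ _
  induction h using Completion.induction_on with
  | hp => exact isClosed_closure.preimage (energyIncl hT).continuous
  | ih u =>
    rw [energyIncl_coe]
    exact subset_closure ((SesqForm.FormSpace.equiv hT.opForm_isNonneg).symm u).2

/-- A densely defined symmetric operator `T` with `ran (T + 1) = E` is selfadjoint. -/
theorem IsSymmetricOp.isSelfAdjoint_of_surjective_add_one (hs : T.IsSymmetricOp)
    (hd : Dense (T.domain : Set E)) (hsurj : ∀ f : E, ∃ x : T.domain, T x + x = f) :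
    IsSelfAdjoint T := by
  have hle : T ≤ T† := IsFormalAdjoint.le_adjoint hd hs
  refine isSelfAdjoint_def.2 (le_antisymm (le_of_eqLocus_ge fun y hy => ?_) hle)
  obtain ⟨x, hx⟩ := hsurj (T† ⟨y, hy⟩ + y)
  -- Writing `y - x = T z + z` gives `‖y - x‖² = (z, (T† y + y) - (T x + x)) = 0`.
  have hyx : y = x := by
    obtain ⟨z, hz⟩ := hsurj (y - x)
    rw [← sub_eq_zero, ← inner_self_eq_zero (𝕜 := ℂ)]
    nth_rewrite 1 [← hz]
    have h1 := (adjoint_isFormalAdjoint hd).symm z ⟨y, hy⟩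
    have h2 := hs z x
    have h3 : inner ℂ (z : E) (T x + x) = inner ℂ (z : E) (T† ⟨y, hy⟩ + y) := by rw [hx]
    simp only [inner_add_left, inner_add_right, inner_sub_right] at h1 h2 h3 ⊢
    rw [h1, h2]
    linear_combination -h3
  subst hyx
  exact ⟨hy, x.2, (hle.2 (x := x) (y := ⟨x, hy⟩) rfl).symm⟩

end LinearPMap

/-! ### Kernel restrictions and adjoints -/

namespace LinearPMap

variable {E : Type*} [NormedAddCommGroup E] [InnerProductSpace ℂ E]
  {K : Type*} [AddCommGroup K] [Module ℂ K] {L : Submodule ℂ E}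

theorem mem_restrictKer_domain {T : E →ₗ.[ℂ] E} {Γ : L →ₗ[ℂ] K} (hL : L ≤ T.domain) {x : E} :
    x ∈ (T.restrictKer Γ).domain ↔ ∃ u : L, Γ u = 0 ∧ (u : E) = x := by
  constructor
  · rintro ⟨⟨u, hu, rfl⟩, -⟩
    exact ⟨u, hu, rfl⟩
  · rintro ⟨u, hu, rfl⟩
    exact ⟨⟨u, hu, rfl⟩, hL u.2⟩

theorem restrictKer_apply {T : E →ₗ.[ℂ] E} {Γ : L →ₗ[ℂ] K} (hL : L ≤ T.domain) (u : L)
    (x : (T.restrictKer Γ).domain) (h : (u : E) = x) :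
    T.restrictKer Γ x = T (Submodule.inclusion hL u) :=
  domRestrict_apply h.symm

variable [CompleteSpace E]

/-- A symmetric operator `S` is contained in each selfadjoint restriction of `S†`. -/
theorem le_of_isSelfAdjoint_of_le_adjoint {S A : E →ₗ.[ℂ] E} (hS : Dense (S.domain : Set E))
    (hA : IsSelfAdjoint A) (hle : A ≤ S†) : S ≤ A := by
  rw [← isSelfAdjoint_def.1 hA]
  refine IsFormalAdjoint.le_adjoint hA.dense_domain fun x y => ?_
  rw [hle.2 (x := x) (y := ⟨x, hle.1 x.2⟩) rfl]
  exact adjoint_isFormalAdjoint hS ⟨x, hle.1 x.2⟩ y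

/-- A closed densely defined operator `S` contains `S††`: if `(S† x, y) = (x, z)` for all
`x ∈ dom S†`, then `y ∈ dom S`. -/
theorem mem_domain_of_isClosed {S : E →ₗ.[ℂ] E} (hS : Dense (S.domain : Set E))
    (hc : S.IsClosed) {y z : E} (h : ∀ x : S†.domain, inner ℂ (S† x) y = inner ℂ (x : E) z) :
    y ∈ S.domain := by
  let G : Submodule ℂ (WithLp 2 (E × E)) :=
    S.graph.comap (WithLp.linearEquiv 2 ℂ (E × E)).toLinearMap
  have hG : _root_.IsClosed (G : Set (WithLp 2 (E × E))) :=
    IsClosed.preimage (WithLp.prod_continuous_ofLp 2 E E) hc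
  -- A pair `p` is orthogonal to the graph of `S` exactly when `p.snd ∈ dom S†` and `S† p.snd =
  -- -p.fst`; hypothesis `h` then says that `(y, z)` is orthogonal to `p`.
  have hmem : WithLp.toLp 2 (y, z) ∈ Gᗮᗮ := by
    rw [Submodule.mem_orthogonal]
    intro p hp
    rw [Submodule.mem_orthogonal] at hp
    have hp' (x : S.domain) : inner ℂ (x : E) p.fst + inner ℂ (S x) p.snd = 0 := by
      have h1 := hp (WithLp.toLp 2 ((x : E), S x)) (S.mem_graph x)
      simpa [WithLp.prod_inner_apply] using h1
    have hw (x : S.domain) : inner ℂ (-p.fst) (x : E) = inner ℂ p.snd (S x) := by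
      rw [← inner_conj_symm, ← inner_conj_symm p.snd, inner_neg_right]
      congr 1
      linear_combination -hp' x
    have hd := mem_adjoint_domain_of_exists p.snd ⟨_, hw⟩
    have h2 := h ⟨p.snd, hd⟩
    rw [adjoint_apply_eq hS ⟨p.snd, hd⟩ hw, inner_neg_left] at h2
    rw [WithLp.prod_inner_apply]
    change inner ℂ p.fst y + inner ℂ p.snd z = 0
    change -inner ℂ p.fst y = inner ℂ p.snd z at h2
    linear_combination -h2
  have : CompleteSpace G := hG.completeSpace_coe
  rw [Submodule.orthogonal_orthogonal] at hmem
  obtain ⟨x, hx, -⟩ := S.mem_graph_iff.1 hmem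
  rw [show y = x from hx.symm]
  exact x.2

end LinearPMap

/-! ### Consequences of Green's identity and of nonnegativity -/

namespace GeneralizedBoundaryTriplet

variable {E : Type*} [NormedAddCommGroup E] [InnerProductSpace ℂ E] [CompleteSpace E]
  {K : Type*} [NormedAddCommGroup K] [InnerProductSpace ℂ K] {S : E →ₗ.[ℂ] E}
  (B : GeneralizedBoundaryTriplet S K)

/-- The operator `S†` on the common domain of the boundary mappings. -/
def act : B.L →ₗ[ℂ] E := S†.toFun ∘ₗ Submodule.inclusion B.le_domain

theorem mem_ext₀ {x : E} : x ∈ B.ext₀.domain ↔ ∃ u : B.L, B.Γ₀ u = 0 ∧ (u : E) = x :=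
  LinearPMap.mem_restrictKer_domain B.le_domain

theorem mem_ext₁ {x : E} : x ∈ B.ext₁.domain ↔ ∃ u : B.L, B.Γ₁ u = 0 ∧ (u : E) = x :=
  LinearPMap.mem_restrictKer_domain B.le_domain

theorem ext₀_apply (u : B.L) (x : B.ext₀.domain) (h : (u : E) = x) : B.ext₀ x = B.act u :=
  LinearPMap.restrictKer_apply B.le_domain u x h

theorem ext₁_apply (u : B.L) (x : B.ext₁.domain) (h : (u : E) = x) : B.ext₁ x = B.act u :=
  LinearPMap.restrictKer_apply B.le_domain u x h

theorem ext₀_le_adjoint : B.ext₀ ≤ S† := LinearPMap.domRestrict_le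

theorem ext₁_le_adjoint : B.ext₁ ≤ S† := LinearPMap.domRestrict_le

theorem mainTransform_apply (u : B.L) (h : B.inMap u ∈ B.mainTransform.domain) :
    B.mainTransform ⟨B.inMap u, h⟩ = B.outMap u := by
  change B.outMap ((LinearEquiv.ofInjective B.inMap B.inMap_injective).symm
    (LinearEquiv.ofInjective B.inMap B.inMap_injective u)) = _
  rw [LinearEquiv.symm_apply_apply]

theorem inMap_mem (u : B.L) : B.inMap u ∈ B.mainTransform.domain := ⟨u, rfl⟩

theorem inner_inMap_outMap (u v : B.L) : inner ℂ (B.inMap u) (B.outMap v)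
    = inner ℂ (u : E) (B.act v) - inner ℂ (B.Γ₀ u) (B.Γ₁ v) := by
  rw [WithLp.prod_inner_apply, sub_eq_add_neg, ← inner_neg_right]
  rfl

/-- The boundary term vanishes on `ker Γ₀` and on `ker Γ₁`, so both extensions inherit nonnegativity
from the main transform. -/
theorem inner_act_sub_nonneg (hA : B.mainTransform.IsNonnegOp) (u : B.L) :
    0 ≤ inner ℂ (u : E) (B.act u) - inner ℂ (B.Γ₀ u) (B.Γ₁ u) := by
  have h := hA ⟨B.inMap u, B.inMap_mem u⟩
  rwa [mainTransform_apply, inner_inMap_outMap] at h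

theorem green_act (x y : B.L) : inner ℂ (y : E) (B.act x) - inner ℂ (B.act y) (x : E) =
    inner ℂ (B.Γ₀ y) (B.Γ₁ x) - inner ℂ (B.Γ₁ y) (B.Γ₀ x) := B.green x y

theorem ext₀_isNonnegOp (hA : B.mainTransform.IsNonnegOp) : B.ext₀.IsNonnegOp := by
  intro x
  obtain ⟨u, hu, hx⟩ := B.mem_ext₀.1 x.2
  have h := B.inner_act_sub_nonneg hA u
  rwa [hu, inner_zero_left, sub_zero, hx, ← B.ext₀_apply u x hx] at h

theorem ext₁_isNonnegOp (hA : B.mainTransform.IsNonnegOp) : B.ext₁.IsNonnegOp := by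
  intro x
  obtain ⟨u, hu, hx⟩ := B.mem_ext₁.1 x.2
  have h := B.inner_act_sub_nonneg hA u
  rwa [hu, inner_zero_right, sub_zero, hx, ← B.ext₁_apply u x hx] at h

theorem ext₁_isSymmetricOp : B.ext₁.IsSymmetricOp := by
  intro x y
  obtain ⟨u, hu, hx⟩ := B.mem_ext₁.1 x.2
  obtain ⟨v, hv, hy⟩ := B.mem_ext₁.1 y.2
  have h := B.green_act v u
  rw [hu, hv, inner_zero_left, inner_zero_right, sub_zero, hx, hy, ← B.ext₁_apply u x hx,
    ← B.ext₁_apply v y hy, sub_eq_zero] at h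
  exact h.symm

/-- If both boundary values of `u` vanish, Green's identity reads `(S* w, u) = (w, S* u)` for `w ∈
L`. Graph-norm density of `L` extends it to `dom S*`, whence `u ∈ dom S** = dom S`. -/
theorem ext₁_inf_ext₀_le (hS : Dense (S.domain : Set E)) (hc : S.IsClosed) :
    B.ext₁.domain ⊓ B.ext₀.domain ≤ S.domain := by
  rintro x ⟨h1, h0⟩
  obtain ⟨u, hu1, rfl⟩ := B.mem_ext₁.1 h1
  obtain ⟨u', hu0, hu⟩ := B.mem_ext₀.1 h0
  obtain rfl : u' = u := Subtype.ext hu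
  refine LinearPMap.mem_domain_of_isClosed hS hc (z := B.act u') fun y => ?_
  obtain ⟨w, hw, hSw⟩ := B.dense y
  refine tendsto_nhds_unique (hSw.inner tendsto_const_nhds) ?_
  refine (hw.inner tendsto_const_nhds).congr fun n => ?_
  have h := B.green_act u' (w n)
  rw [hu1, hu0, inner_zero_right, inner_zero_right, sub_zero, sub_eq_zero] at h
  exact h

end GeneralizedBoundaryTriplet

end

/-! ### The main theorem -/

theorem theorem7 {E : Type*} [NormedAddCommGroup E] [InnerProductSpace ℂ E] [CompleteSpace E]
    {K : Type*} [NormedAddCommGroup K] [InnerProductSpace ℂ K] [CompleteSpace K]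
    (S : E →ₗ.[ℂ] E) (hS_dense : Dense (S.domain : Set E)) (hS_closed : S.IsClosed)
    (hS_symm : S.IsSymmetricOp)
    (B : GeneralizedBoundaryTriplet S K)
    (hA_sa : IsSelfAdjoint B.mainTransform) (hA_nonneg : B.mainTransform.IsNonnegOp)
    (Γt : B.ext₁.closedForm.domain →ₗ[ℂ] K)
    (hΓt : ∀ u : B.L, ∃ h : (u : E) ∈ B.ext₁.closedForm.domain, Γt ⟨u, h⟩ = B.Γ₀ u)
    (hA_dom : (B.mainTransform.closedForm.domain : Set (WithLp 2 (E × K))) =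
      {p | ∃ v : B.ext₁.closedForm.domain, p = WithLp.toLp 2 ((v : E), Γt v)})
    (hA_form : ∀ (v : B.ext₁.closedForm.domain)
      (h : WithLp.toLp 2 ((v : E), Γt v) ∈ B.mainTransform.closedForm.domain),
      B.mainTransform.closedForm.toFun ⟨_, h⟩ ⟨_, h⟩ = B.ext₁.closedForm.toFun v v) :
    IsSpecialPair S B.ext₀ B.ext₁ := by
  have hA_dense := hA_sa.dense_domain
  have hA_symm : B.mainTransform.IsSymmetricOp := by
    have h := LinearPMap.adjoint_isFormalAdjoint hA_dense
    rwa [LinearPMap.isSelfAdjoint_def.1 hA_sa] at h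
  have hn0 := B.ext₀_isNonnegOp hA_nonneg
  have hn1 := B.ext₁_isNonnegOp hA_nonneg
  have hs1 := B.ext₁_isSymmetricOp
  have hsa0 : IsSelfAdjoint B.ext₀ := B.selfAdjoint₀
  have hs0 : B.ext₀.IsSymmetricOp := by
    have h := LinearPMap.adjoint_isFormalAdjoint hsa0.dense_domain
    rwa [LinearPMap.isSelfAdjoint_def.1 hsa0] at h
  have hcl0 := LinearPMap.closedForm_isClosureOf hn0 hs0
  have hcl1 := LinearPMap.closedForm_isClosureOf hn1 hs1
  have hmem (v : B.ext₁.closedForm.domain) :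
      WithLp.toLp 2 ((v : E), Γt v) ∈ B.mainTransform.closedForm.domain := by
    rw [← SetLike.mem_coe, hA_dom]
    exact ⟨v, rfl⟩
  let φ : B.ext₁.closedForm.domain →ₗ[ℂ] B.mainTransform.closedForm.domain :=
    LinearMap.codRestrict _ ((WithLp.linearEquiv 2 ℂ (E × K)).symm.toLinearMap ∘ₗ
      (B.ext₁.closedForm.domain.subtype.prod Γt)) hmem
  have hφ := SesqForm.map_eq_of_map_self_eq φ fun v => hA_form v (hmem v)
  have hinMap (u : B.L) : (φ ⟨u, (hΓt u).1⟩ : WithLp 2 (E × K)) = B.inMap u := by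
    change WithLp.toLp 2 ((u : E), Γt ⟨u, (hΓt u).1⟩) = WithLp.toLp 2 ((u : E), B.Γ₀ u)
    rw [(hΓt u).2]
  -- Here `u` runs over all of `L`, not only over `ker Γ₁`; this is what the main transform adds to
  -- the representation of `S₁[·,·]` by `S₁` itself.
  have hrep (x : B.ext₁.closedForm.domain) (u : B.L) :
      B.ext₁.closedForm.toFun x ⟨u, (hΓt u).1⟩ = inner ℂ (B.outMap u) (φ x : WithLp 2 (E × K)) := by
    rw [← hφ, ← B.mainTransform_apply u (B.inMap_mem u)]
    have hw : B.inMap u ∈ B.mainTransform.closedForm.domain := hinMap u ▸ (φ _).2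
    rw [← LinearPMap.closedForm_apply_right hA_nonneg hA_symm (φ x)
      ⟨B.inMap u, B.inMap_mem u⟩ hw]
    congr 1
    exact Subtype.ext (hinMap u)
  have hd1 : Dense (B.ext₁.domain : Set E) := by
    -- `dom S₀ ⊆ L ⊆ 𝒟[S₁]` lies in the closure of `dom S₁`, and `dom S₀` is dense.
    refine dense_closure.1 (hsa0.dense_domain.mono fun x hx => ?_)
    obtain ⟨u, -, rfl⟩ := B.mem_ext₀.1 hx
    exact LinearPMap.closedForm_domain_subset_closure hn1 hs1 (hΓt u).1
  have hsa1 : IsSelfAdjoint B.ext₁ := by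
    refine hs1.isSelfAdjoint_of_surjective_add_one hd1 fun f => ?_
    obtain ⟨x, hx⟩ := hcl1.1.2.1.exists_add_inner_eq hcl1.1.1 f
    -- The weak equation for `x`, tested on `L`, says that the adjoint of the main transform maps
    -- `(x, Γt x)` to `(f - x, 0)`; the zero component will become `Γ₁ x = 0`.
    have hw (w : B.mainTransform.domain) : inner ℂ (WithLp.toLp 2 (f - x, (0 : K))) (w : _)
        = inner ℂ (φ x : WithLp 2 (E × K)) (B.mainTransform w) := by
      obtain ⟨u, hu⟩ := w.2
      obtain rfl : ⟨B.inMap u, B.inMap_mem u⟩ = w := Subtype.ext hu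
      rw [B.mainTransform_apply, ← inner_conj_symm, ← inner_conj_symm (φ x : WithLp 2 (E × K)),
        ← hrep, eq_sub_of_add_eq (hx ⟨u, (hΓt u).1⟩), ← inner_sub_right]
      congr 1
      rw [WithLp.prod_inner_apply]
      change inner ℂ (u : E) (f - x) + inner ℂ (B.Γ₀ u) 0 = _
      rw [inner_zero_right, add_zero]
    have hdom := LinearPMap.mem_adjoint_domain_of_exists _ ⟨_, hw⟩
    have hval := LinearPMap.adjoint_apply_eq hA_dense ⟨_, hdom⟩ hw
    have hle : B.mainTransform† ≤ B.mainTransform := (LinearPMap.isSelfAdjoint_def.1 hA_sa).le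
    obtain ⟨u, hu⟩ := hle.1 hdom
    rw [hle.2 (x := ⟨_, hdom⟩) (y := ⟨B.inMap u, B.inMap_mem u⟩) hu.symm,
      B.mainTransform_apply] at hval
    have hux : (u : E) = x := congrArg WithLp.fst hu
    have hSu : B.act u = f - x := congrArg WithLp.fst hval
    have hΓu : -B.Γ₁ u = 0 := congrArg WithLp.snd hval
    have hu1 : (u : E) ∈ B.ext₁.domain := B.mem_ext₁.2 ⟨u, neg_eq_zero.1 hΓu, rfl⟩
    refine ⟨⟨u, hu1⟩, ?_⟩
    rw [B.ext₁_apply u ⟨u, hu1⟩ rfl, hSu, ← hux, sub_add_cancel]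
  have hle0 : S ≤ B.ext₀ :=
    LinearPMap.le_of_isSelfAdjoint_of_le_adjoint hS_dense hsa0 B.ext₀_le_adjoint
  have hle1 : S ≤ B.ext₁ :=
    LinearPMap.le_of_isSelfAdjoint_of_le_adjoint hS_dense hsa1 B.ext₁_le_adjoint
  refine ⟨hS_dense, hS_symm, fun u => ?_, hle0, hle1, hsa0, hsa1, hn0, hn1,
    le_antisymm (B.ext₁_inf_ext₀_le hS_dense hS_closed) (le_inf hle1.1 hle0.1),
    hcl0.1.2.1, hcl0.2 ⟨hcl1.1.1, hcl1.1.2.1, ?_⟩⟩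
  · rw [hle1.2 (x := u) (y := ⟨u, hle1.1 u.2⟩) rfl]
    exact hn1 ⟨u, hle1.1 u.2⟩
  · have hsub : B.ext₀.opForm.domain ≤ B.ext₁.closedForm.domain := fun x hx => by
      obtain ⟨u, -, rfl⟩ := B.mem_ext₀.1 hx
      exact (hΓt u).1
    refine ⟨hsub, fun x y => ?_⟩
    obtain ⟨u, hu, hx⟩ := B.mem_ext₀.1 x.2
    obtain ⟨v, hv, hy⟩ := B.mem_ext₀.1 y.2
    have h1 : Submodule.inclusion hsub x = ⟨u, (hΓt u).1⟩ := Subtype.ext hx.symm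
    have h2 : Submodule.inclusion hsub y = ⟨v, (hΓt v).1⟩ := Subtype.ext hy.symm
    -- `Γ₀ u = 0` removes the boundary term here; Green's identity then moves `S*` from `v` to `u`.
    have h3 := hrep ⟨u, (hΓt u).1⟩ v
    rw [hinMap, ← inner_conj_symm, B.inner_inMap_outMap, hu, inner_zero_left, sub_zero,
      inner_conj_symm] at h3
    have h4 := B.green_act u v
    rw [hu, hv, inner_zero_left, inner_zero_right, sub_zero, sub_eq_zero] at h4
    rw [h1, h2, h3, ← h4, ← B.ext₀_apply u x hx, hy]
    exact LinearPMap.opForm_apply _ _ _
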